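/- Let $H>0$ and $M\in\mathbb C$ with $\Re M>0$, and put $\phi(t)=(1-e^{-Ht})/H$. Let $F(\alpha,\beta;\gamma;\zeta)$ be Gauss's hypergeometric function and $$E(r,t;0,b;M)=4^{-\frac MH}e^{M(b+t)}\Big(\big(e^{-Hb}+e^{-Ht}\big)^2-(Hr)^2\Big)^{\frac MH-\frac12}F\Big(\tfrac12-\tfrac MH,\tfrac12-\tfrac MH;1;\tfrac{(e^{-Hb}-e^{-Ht})^2-(Hr)^2}{(e^{-Hb}+e^{-Ht})^2-(Hr)^2}\Big),$$ $$K_0(r,t;M)=-\Big[\tfrac{\partial}{\partial b}E(r,t;0,b;M)\Big]_{b=0},\qquad K_1(r,t;M)=E(r,t;0,0;M).$$ The derivative defining $K_0$ exists for $t>0$, $0\le r\le\phi(t)$, and $\partial_tE(r,t;0,b;M)$ exists for $0\le b<t$, $0\le r\le (e^{-Hb}-e^{-Ht})/H$. The integrals below converge absolutely and satisfy the following bounds. (1) For every $a>-1$ there is a constant $C=C(H,M,a)$ such that for all $t>0$ $$\int_0^1\phi(t)^as^a\,|K_1(\phi(t)s,t;M)|\,\phi(t)\,ds\le C\,e^{-aHt}(e^{Ht}-1)^{a+1}(e^{Ht}+1)^{\frac{\Re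 M}{H}-1}.$$ In particular, for large $t$ the left-hand side is at most $C'e^{\Re M\,t}$ with $C'=C'(H,M,a)$. (2) For every $a>-1$ there is a constant $C=C(H,M,a)$ such that for all $t>0$ $$\int_0^1\phi(t)^as^a\,|K_0(\phi(t)s,t;M)|\,\phi(t)\,ds\le C\,(e^{Ht}-1)^{a+1}e^{-aHt}\times\begin{cases}(e^{Ht}+1)^{-1/2}&\text{if }\Re M<H/2,\\ e^{\Re M\,t}(e^{Ht}+1)^{-1}&\text{if }\Re M>H/2.\end{cases}$$ In particular, for large $t$ the left-hand side is at most $C'e^{\frac12Ht}$ if $\Re M<H/2$ and at most $C'e^{\Re M\,t}$ if $\Re M>H/2$, with $C'=C'(H,M,a)$. (3) There is a constant $C=C(H,M)$ such that for all $t,b$ with $0\le b<t$ $$\int_0^{(e^{-Hb}-e^{-Ht})/H}|\partial_tE(r,t;0,b;M)|\,dr\le C\times\begin{cases}e^{\frac12H(t-b)}&\text{if }\Re M<H/2,\\ e^{(\Re M+H)(t-b)}&\text{if }\Re M>H/2.\end{cases}$$ -/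

import Mathlib

open Filter MeasureTheory

namespace DeSitter

/-- The distance function `φ(t) = (1 - e^{-Ht}) / H`. -/
noncomputable def phi (H t : ℝ) : ℝ := (1 - Real.exp (-(H * t))) / H

/-- The base `(e^{-Hb} + e^{-Ht})² - (Hr)²` of the complex power in the kernel `E`;
it is positive when `0 ≤ H r ≤ |e^{-Hb} - e^{-Ht}|`. -/
noncomputable def kernelBase (H r t b : ℝ) : ℝ :=
  (Real.exp (-(H * b)) + Real.exp (-(H * t))) ^ 2 - (H * r) ^ 2

/-- The argument of the hypergeometric function in the kernel `E`;
it lies in `[0, 1)` when `0 ≤ H r ≤ |e^{-Hb} - e^{-Ht}|`. -/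
noncomputable def kernelArg (H r t b : ℝ) : ℝ :=
  ((-Real.exp (-(H * t)) + Real.exp (-(H * b))) ^ 2 - (r * H) ^ 2) / kernelBase H r t b

/-- The kernel `E(r, t; 0, b; M)`, with `₂F₁` the Gauss hypergeometric function. -/
noncomputable def kernelE (H : ℝ) (M : ℂ) (r t b : ℝ) : ℂ :=
  (4 : ℂ) ^ (-(M / (H : ℂ))) * Complex.exp (M * ((b : ℂ) + (t : ℂ)))
    * (kernelBase H r t b : ℂ) ^ (M / (H : ℂ) - 1 / 2)
    * ordinaryHypergeometric (1 / 2 - M / (H : ℂ)) (1 / 2 - M / (H : ℂ)) (1 : ℂ)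
        (kernelArg H r t b : ℂ)

/-- The kernel `K₀(r, t; M) = -[∂_b E(r, t; 0, b; M)]_{b = 0}`. -/
noncomputable def kernelK0 (H : ℝ) (M : ℂ) (r t : ℝ) : ℂ :=
  -deriv (fun b : ℝ => kernelE H M r t b) 0

/-- The kernel `K₁(r, t; M) = E(r, t; 0, 0; M)`. -/
noncomputable def kernelK1 (H : ℝ) (M : ℂ) (r t : ℝ) : ℂ :=
  kernelE H M r t 0

/-- The time derivative `∂_t E(r, t; 0, b; M)`. -/
noncomputable def kernelEt (H : ℝ) (M : ℂ) (r t b : ℝ) : ℂ :=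
  deriv (fun τ : ℝ => kernelE H M r τ b) t

/-- The integrand `φ(t)^a s^a |K(φ(t) s, t)| φ(t)` of the weighted integral over `s ∈ [0, 1]`. -/
noncomputable def weighted (H a : ℝ) (K : ℝ → ℝ → ℂ) (t s : ℝ) : ℝ :=
  phi H t ^ a * s ^ a * ‖K (phi H t * s) t‖ * phi H t

end DeSitter

/-!
Put `μ = Re M / H`, `X = e^{-Hb}`, `Y = e^{-Ht}`, `q = Y / X`, and let `B` and `z` be the base and
the argument of the kernel, so that `1 - z = 4 X Y / B`.

The hypergeometric function involved is `F(a, a; 1; z)` with `Re a = 1/2 - μ < 1/2`. Raabe's test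
shows that its Taylor coefficients are absolutely summable, so `F` is bounded on the unit disc, and
Cauchy's estimate gives `(1 - |z|) |F'(z)| ≤ C`. Since `∂_b z = (1 - z) (H + ∂_b B / B)`, this is
exactly what is needed to differentiate the kernel: with constants depending on `H` and `M` only,
`|E| ≤ C e^{Re M (b + t)} B^{μ - 1/2}` (`exists_norm_kernelE_le`) and
`|∂_b E| ≤ C e^{Re M (b + t)} B^{μ - 3/2} (X + Y)²` (`exists_norm_kernelEDeriv_le`). The kernel is
symmetric in `b` and `t`, so `∂_t E` obeys the second bound too.

With `r = s (X - Y) / H` the base becomes `X² β`, where `β = (1 + q)² - ((1 - q) s)² ≥ 1 - s + q`,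
and everything reduces to the integrals of `s^a β^p` over `[0, 1]` with `p = μ - 1/2` or
`p = μ - 3/2`. For `p ≠ -1` they are at most `C q^{min(p + 1, 0)}`
(`integral_rpow_mul_scaledBase_rpow_le`). The exponent `p = -1`, which would produce a logarithm,
corresponds to `Re M = H / 2` for the derivatives. The resulting bounds are
`C (1 - e^{-Ht})^{a+1} e^{κt}` with `κ = Re M` for `K₁` and `κ = max (Re M) (H / 2)` for `K₀`, and
`C e^{κ(t - b)}` with the latter `κ` for `∂_t E`.
-/

namespace DeSitter

/-! ### Gauss's series `F(a, a; 1; z)` on the unit disc -/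

/-- Raabe's test in a form that telescopes. -/
theorem summable_of_succ_mul_le {e : ℕ → ℝ} (he : ∀ n, 0 ≤ e n) {m : ℝ} (hm : 0 < m) {N : ℕ}
    (h : ∀ n : ℕ, N ≤ n → ((n : ℝ) + 1) * e (n + 1) ≤ ((n : ℝ) - m) * e n) : Summable e := by
  rw [← summable_nat_add_iff N]
  refine summable_of_sum_range_le (c := (N : ℝ) * e N / m) (fun n => he _) fun k => ?_
  have key : m * ∑ i ∈ Finset.range k, e (i + N)
      ≤ (N : ℝ) * e N - ((k : ℝ) + N) * e (k + N) := by
    induction k with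
    | zero => simp
    | succ k ih =>
      have h1 := h (k + N) (by omega)
      rw [Finset.sum_range_succ, show k + 1 + N = k + N + 1 by omega]
      push_cast at h1 ⊢
      linarith
  rw [le_div_iff₀ hm]
  have : 0 ≤ ((k : ℝ) + N) * e (k + N) := mul_nonneg (by positivity) (he _)
  linarith

/-- The coefficients behave like `n ^ (2 Re a - 2)`, hence are summable for `Re a < 1/2`. -/
theorem summable_norm_ordinaryHypergeometricCoefficient {a : ℂ} (ha : a.re < 1 / 2) :
    Summable fun n => ‖ordinaryHypergeometricCoefficient a a (1 : ℂ) n‖ := by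
  set m : ℝ := 1 / 2 - a.re with hm
  have hm0 : 0 < m := by rw [hm]; linarith
  obtain ⟨N, hN⟩ := exists_nat_ge ((m + (a.re ^ 2 + a.im ^ 2)) / m)
  refine summable_of_succ_mul_le (fun n => norm_nonneg _) hm0 (N := N) fun n hn => ?_
  have hn1 : (0 : ℝ) < (n : ℝ) + 1 := by positivity
  have hrec : ordinaryHypergeometricCoefficient a a (1 : ℂ) (n + 1)
      = ordinaryHypergeometricCoefficient a a (1 : ℂ) n * ((a + n) ^ 2 / ((n : ℂ) + 1) ^ 2) := by
    simp only [ordinaryHypergeometricCoefficient, ascPochhammer_succ_eval, Nat.factorial_succ,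
      Nat.cast_mul, Nat.cast_add, Nat.cast_one, mul_inv_rev, div_eq_mul_inv, add_comm (1 : ℂ),
      ← inv_pow]
    ring
  have hnorm : ‖(a + n) ^ 2 / ((n : ℂ) + 1) ^ 2‖
      = ((a.re + n) ^ 2 + a.im ^ 2) / ((n : ℝ) + 1) ^ 2 := by
    rw [norm_div, norm_pow, norm_pow, Complex.sq_norm, Complex.normSq_apply,
      show ((n : ℂ) + 1) = ((n + 1 : ℕ) : ℂ) by push_cast; rfl, Complex.norm_natCast]
    simp only [Complex.add_re, Complex.natCast_re, Complex.add_im, Complex.natCast_im, add_zero]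
    push_cast
    ring
  have hnN : (m + (a.re ^ 2 + a.im ^ 2)) ≤ n * m := by
    rw [div_le_iff₀ hm0] at hN
    exact hN.trans (by gcongr)
  -- The ratio of consecutive norms is `1 - (1 + 2m)/(n + 1) + O(n⁻²)`; half of the excess `2m`
  -- pays for the quadratic error once `n ≥ N`.
  have hratio : ((n : ℝ) + 1) * (((a.re + n) ^ 2 + a.im ^ 2) / ((n : ℝ) + 1) ^ 2) ≤ n - m := by
    rw [mul_div_assoc', div_le_iff₀ (by positivity)]
    have : (a.re + n) ^ 2 + a.im ^ 2 ≤ ((n : ℝ) - m) * (n + 1) := by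
      have : a.re = 1 / 2 - m := by rw [hm]; ring
      nlinarith
    nlinarith
  rw [hrec, norm_mul, hnorm]
  have := mul_le_mul_of_nonneg_left hratio
    (norm_nonneg (ordinaryHypergeometricCoefficient a a (1 : ℂ) n))
  linarith

theorem norm_ordinaryHypergeometric_term_le (a : ℂ) (n : ℕ) {z : ℂ} (hz : ‖z‖ ≤ 1) :
    ‖ordinaryHypergeometricCoefficient a a (1 : ℂ) n * z ^ n‖
      ≤ ‖ordinaryHypergeometricCoefficient a a (1 : ℂ) n‖ := by
  rw [norm_mul, norm_pow]
  exact mul_le_of_le_one_right (norm_nonneg _) (pow_le_one₀ (norm_nonneg _) hz)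

theorem ordinaryHypergeometric_eq_tsum_mul (a z : ℂ) :
    ordinaryHypergeometric a a (1 : ℂ) z
      = ∑' n, ordinaryHypergeometricCoefficient a a (1 : ℂ) n * z ^ n := by
  rw [ordinaryHypergeometric_eq_tsum]
  rfl

theorem exists_norm_ordinaryHypergeometric_le {a : ℂ} (ha : a.re < 1 / 2) :
    ∃ C : ℝ, 0 < C ∧ ∀ z : ℂ, ‖z‖ ≤ 1 → ‖ordinaryHypergeometric a a (1 : ℂ) z‖ ≤ C := by
  have hs := summable_norm_ordinaryHypergeometricCoefficient ha
  refine ⟨(∑' n, ‖ordinaryHypergeometricCoefficient a a (1 : ℂ) n‖) + 1,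
    add_pos_of_nonneg_of_pos (tsum_nonneg fun n => norm_nonneg _) one_pos, fun z hz => ?_⟩
  rw [ordinaryHypergeometric_eq_tsum_mul]
  have := tsum_of_norm_bounded hs.hasSum
    fun n => norm_ordinaryHypergeometric_term_le a n hz
  linarith

theorem differentiableOn_ordinaryHypergeometric {a : ℂ} (ha : a.re < 1 / 2) :
    DifferentiableOn ℂ (ordinaryHypergeometric a a (1 : ℂ)) (Metric.ball (0 : ℂ) 1) := by
  have hs := summable_norm_ordinaryHypergeometricCoefficient ha
  refine (Complex.differentiableOn_tsum_of_summable_norm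
    (F := fun n z => ordinaryHypergeometricCoefficient a a (1 : ℂ) n * z ^ n) hs
    (fun n => by fun_prop) Metric.isOpen_ball fun n z hz =>
      norm_ordinaryHypergeometric_term_le a n (mem_ball_zero_iff.1 hz).le).congr fun z _ =>
    ordinaryHypergeometric_eq_tsum_mul a z

/-- Cauchy's estimate on the disc of radius `(1 - ‖z‖) / 2` about `z`. -/
theorem exists_norm_deriv_ordinaryHypergeometric_le {a : ℂ} (ha : a.re < 1 / 2) :
    ∃ C : ℝ, 0 < C ∧ ∀ z : ℂ, ‖z‖ < 1 →
      (1 - ‖z‖) * ‖deriv (ordinaryHypergeometric a a (1 : ℂ)) z‖ ≤ C := by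
  obtain ⟨C, hC, hb⟩ := exists_norm_ordinaryHypergeometric_le ha
  refine ⟨2 * C, by positivity, fun z hz => ?_⟩
  have hR : 0 < (1 - ‖z‖) / 2 := by linarith
  have hsub : Metric.closedBall z ((1 - ‖z‖) / 2) ⊆ Metric.ball (0 : ℂ) 1 := by
    refine Metric.closedBall_subset_ball' ?_
    rw [dist_zero_right]
    linarith
  have := Complex.norm_deriv_le_of_forall_mem_sphere_norm_le hR
    ((differentiableOn_ordinaryHypergeometric ha).diffContOnCl_ball hsub) (C := C)
    fun w hw => hb w (mem_ball_zero_iff.1 (hsub (Metric.sphere_subset_closedBall hw))).le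
  rw [le_div_iff₀ hR] at this
  linarith

/-! ### Integrals over the radial variable -/

/-- The base of the kernel in the scaled radial variable `s ∈ [0, 1]`, divided by `e^{-2Hb}`; here
`q = e^{-H(t-b)}`. -/
noncomputable def scaledBase (q s : ℝ) : ℝ := (1 + q) ^ 2 - ((1 - q) * s) ^ 2

theorem le_scaledBase {q s : ℝ} (hq : 0 ≤ q) (hs : s ∈ Set.Icc (0 : ℝ) 1) :
    1 - s + q ≤ scaledBase q s := by
  obtain ⟨h0, h1⟩ := hs
  have e : scaledBase q s - (1 - s + q)
      = s * (1 - s) + (1 - s) * (1 + s) * q ^ 2 + q * (1 + 2 * s ^ 2) := by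
    rw [scaledBase]; ring
  have : 0 ≤ s * (1 - s) + (1 - s) * (1 + s) * q ^ 2 + q * (1 + 2 * s ^ 2) := by
    have : 0 ≤ 1 - s := by linarith
    positivity
  linarith

theorem scaledBase_pos {q s : ℝ} (hq : 0 < q) (hs : s ∈ Set.Icc (0 : ℝ) 1) :
    0 < scaledBase q s :=
  lt_of_lt_of_le (by linarith [hs.2]) (le_scaledBase hq.le hs)

theorem continuousOn_scaledBase_rpow {q : ℝ} (hq : 0 < q) (p : ℝ) :
    ContinuousOn (fun s => scaledBase q s ^ p) (Set.Icc 0 1) :=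
  ContinuousOn.rpow_const (by unfold scaledBase; fun_prop)
    fun s hs => Or.inl (scaledBase_pos hq hs).ne'

theorem intervalIntegrable_rpow_mul {a : ℝ} (ha : -1 < a) {f : ℝ → ℝ}
    (hf : ContinuousOn f (Set.Icc 0 1)) :
    IntervalIntegrable (fun s => s ^ a * f s) volume 0 1 :=
  (intervalIntegral.intervalIntegrable_rpow' ha).mul_continuousOn
    (by rwa [Set.uIcc_of_le zero_le_one])

theorem integral_shifted_rpow_le {p : ℝ} (hp : p ≠ -1) :
    ∃ C : ℝ, 0 < C ∧ ∀ q : ℝ, 0 < q → q ≤ 1 →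
      ∫ s in (0 : ℝ)..1, (1 - s + q) ^ p ≤ C * q ^ min (p + 1) 0 := by
  have hint : ∀ q : ℝ, 0 < q → ∫ s in (0 : ℝ)..1, (1 - s + q) ^ p
      = ((1 + q) ^ (p + 1) - q ^ (p + 1)) / (p + 1) := by
    intro q hq
    have h1 : ∫ s in (0 : ℝ)..1, (1 - s + q) ^ p = ∫ s in (0 : ℝ)..1, ((1 + q) - s) ^ p :=
      intervalIntegral.integral_congr fun s _ => by
        rw [show 1 - s + q = 1 + q - s by ring]
    rw [h1, intervalIntegral.integral_comp_sub_left (fun v => v ^ p) (1 + q),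
      show 1 + q - 1 = q by ring, sub_zero, integral_rpow]
    refine Or.inr ⟨hp, ?_⟩
    rw [Set.uIcc_of_le (by linarith)]
    exact fun h => absurd h.1 (by linarith)
  rcases lt_or_gt_of_ne hp with h | h
  · refine ⟨(-(p + 1))⁻¹, inv_pos.2 (by linarith), fun q hq hq1 => ?_⟩
    rw [hint q hq, min_eq_left (by linarith), ← neg_div_neg_eq, div_eq_inv_mul]
    refine mul_le_mul_of_nonneg_left ?_ (inv_pos.2 (by linarith)).le
    have : 0 ≤ (1 + q) ^ (p + 1) := by positivity
    linarith
  · have hp1 : 0 < p + 1 := by linarith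
    refine ⟨2 ^ (p + 1) / (p + 1), by positivity, fun q hq hq1 => ?_⟩
    rw [hint q hq, min_eq_right hp1.le, Real.rpow_zero, mul_one]
    gcongr
    have h1 : (1 + q) ^ (p + 1) ≤ 2 ^ (p + 1) :=
      Real.rpow_le_rpow (by linarith) (by linarith) hp1.le
    have : 0 ≤ q ^ (p + 1) := by positivity
    linarith

/-- The two singularities, of `s ^ a` at `0` and of the base at `s = 1`, are separated by
splitting at `s = 1 / 2`. -/
theorem rpow_mul_scaledBase_rpow_le {a p q s : ℝ} (hp : p < 0) (hq : 0 < q)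
    (hs : s ∈ Set.Ioo (0 : ℝ) 1) :
    s ^ a * scaledBase q s ^ p ≤ (1 / 2) ^ p * s ^ a + 2 ^ |a| * (1 - s + q) ^ p := by
  obtain ⟨h0, h1⟩ := hs
  have hb := le_scaledBase hq.le ⟨h0.le, h1.le⟩
  have hpos : 0 < 1 - s + q := by linarith
  have hle : scaledBase q s ^ p ≤ (1 - s + q) ^ p := Real.rpow_le_rpow_of_nonpos hpos hb hp.le
  rcases le_total s (1 / 2) with h | h
  · have : scaledBase q s ^ p ≤ (1 / 2) ^ p :=
      Real.rpow_le_rpow_of_nonpos (by norm_num) (by linarith) hp.le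
    have h2 : s ^ a * scaledBase q s ^ p ≤ s ^ a * (1 / 2) ^ p := by gcongr
    have : 0 ≤ 2 ^ |a| * (1 - s + q) ^ p := by positivity
    linarith
  · have hsa : s ^ a ≤ 2 ^ |a| := by
      calc s ^ a ≤ s ^ (-|a|) :=
            Real.rpow_le_rpow_of_exponent_ge h0 h1.le (neg_abs_le a)
        _ ≤ (1 / 2) ^ (-|a|) :=
            Real.rpow_le_rpow_of_nonpos (by norm_num) h (by simp)
        _ = 2 ^ |a| := by
            rw [Real.rpow_neg (by norm_num), one_div, Real.inv_rpow (by norm_num), inv_inv]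
    have h2 : s ^ a * scaledBase q s ^ p ≤ 2 ^ |a| * (1 - s + q) ^ p :=
      mul_le_mul hsa hle (Real.rpow_nonneg (hpos.le.trans hb) p) (by positivity)
    have : 0 ≤ (1 / 2 : ℝ) ^ p * s ^ a := by positivity
    linarith

theorem integral_rpow_mul_scaledBase_rpow_le {a p : ℝ} (ha : -1 < a) (hp : p ≠ -1) :
    ∃ C : ℝ, 0 < C ∧ ∀ q : ℝ, 0 < q → q ≤ 1 →
      ∫ s in (0 : ℝ)..1, s ^ a * scaledBase q s ^ p ≤ C * q ^ min (p + 1) 0 := by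
  have ha1 : 0 < a + 1 := by linarith
  have hI : ∫ s in (0 : ℝ)..1, s ^ a = (a + 1)⁻¹ := by
    rw [integral_rpow (Or.inl ha), Real.one_rpow, Real.zero_rpow ha1.ne', sub_zero, one_div]
  have hIa : IntervalIntegrable (fun s : ℝ => s ^ a) volume 0 1 :=
    intervalIntegral.intervalIntegrable_rpow' ha
  rcases lt_or_ge p 0 with h | h
  · obtain ⟨C, hC, hb⟩ := integral_shifted_rpow_le hp
    refine ⟨(1 / 2) ^ p * (a + 1)⁻¹ + 2 ^ |a| * C, by positivity, fun q hq hq1 => ?_⟩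
    have hI2 : IntervalIntegrable (fun s : ℝ => (1 - s + q) ^ p) volume 0 1 := by
      refine ContinuousOn.intervalIntegrable (ContinuousOn.rpow_const (by fun_prop) ?_)
      rw [Set.uIcc_of_le zero_le_one]
      exact fun s hs => Or.inl (by linarith [hs.2])
    calc ∫ s in (0 : ℝ)..1, s ^ a * scaledBase q s ^ p
        ≤ ∫ s in (0 : ℝ)..1, ((1 / 2) ^ p * s ^ a + 2 ^ |a| * (1 - s + q) ^ p) :=
          intervalIntegral.integral_mono_on_of_le_Ioo zero_le_one
            (intervalIntegrable_rpow_mul ha (continuousOn_scaledBase_rpow hq p))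
            ((hIa.const_mul _).add (hI2.const_mul _))
            fun s hs => rpow_mul_scaledBase_rpow_le h hq hs
      _ = (1 / 2) ^ p * (a + 1)⁻¹ * 1 + 2 ^ |a| * ∫ s in (0 : ℝ)..1, (1 - s + q) ^ p := by
          rw [intervalIntegral.integral_add (hIa.const_mul _) (hI2.const_mul _),
            intervalIntegral.integral_const_mul, intervalIntegral.integral_const_mul, hI, mul_one]
      _ ≤ (1 / 2) ^ p * (a + 1)⁻¹ * q ^ min (p + 1) 0 + 2 ^ |a| * (C * q ^ min (p + 1) 0) := by
          have : 1 ≤ q ^ min (p + 1) 0 :=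
            Real.one_le_rpow_of_pos_of_le_one_of_nonpos hq hq1 (min_le_right _ _)
          gcongr
          exact hb q hq hq1
      _ = _ := by ring
  · refine ⟨4 ^ p * (a + 1)⁻¹, by positivity, fun q hq hq1 => ?_⟩
    rw [min_eq_right (by linarith), Real.rpow_zero, mul_one, ← hI,
      ← intervalIntegral.integral_const_mul]
    refine intervalIntegral.integral_mono_on_of_le_Ioo zero_le_one
      (intervalIntegrable_rpow_mul ha (continuousOn_scaledBase_rpow hq p)) (hIa.const_mul _)
      fun s hs => ?_
    have h4 : scaledBase q s ≤ 4 := by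
      unfold scaledBase
      nlinarith [sq_nonneg ((1 - q) * s)]
    rw [mul_comm]
    have := Real.rpow_nonneg hs.1.le a
    gcongr
    exact (scaledBase_pos hq ⟨hs.1.le, hs.2.le⟩).le

/-! ### The kernel and its derivative -/

/-- The derivative of `kernelBase H r t b` in `b`. -/
noncomputable def kernelBaseDeriv (H t b : ℝ) : ℝ :=
  -(2 * H * Real.exp (-(H * b)) * (Real.exp (-(H * b)) + Real.exp (-(H * t))))

/-- The derivative of `kernelE H M r t b` in `b`. -/
noncomputable def kernelEDeriv (H : ℝ) (M : ℂ) (r t b : ℝ) : ℂ :=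
  (4 : ℂ) ^ (-(M / (H : ℂ))) * Complex.exp (M * ((b : ℂ) + (t : ℂ)))
    * (kernelBase H r t b : ℂ) ^ (M / (H : ℂ) - 1 / 2)
    * ((M + (M / (H : ℂ) - 1 / 2) * (kernelBaseDeriv H t b / kernelBase H r t b : ℝ))
        * ordinaryHypergeometric (1 / 2 - M / (H : ℂ)) (1 / 2 - M / (H : ℂ)) (1 : ℂ)
          (kernelArg H r t b : ℂ)
      + ((1 - kernelArg H r t b) * (H + kernelBaseDeriv H t b / kernelBase H r t b) : ℝ)
        * deriv (ordinaryHypergeometric (1 / 2 - M / (H : ℂ)) (1 / 2 - M / (H : ℂ)) (1 : ℂ))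
          (kernelArg H r t b : ℂ))

theorem kernelBase_comm (H r t b : ℝ) : kernelBase H r t b = kernelBase H r b t := by
  unfold kernelBase; ring

theorem kernelArg_comm (H r t b : ℝ) : kernelArg H r t b = kernelArg H r b t := by
  unfold kernelArg; rw [kernelBase_comm H r t b]; ring

/-- The kernel is symmetric in the two times, so one computation gives both `∂_b E` and `∂_t E`. -/
theorem kernelE_comm (H : ℝ) (M : ℂ) (r t b : ℝ) : kernelE H M r t b = kernelE H M r b t := by
  unfold kernelE
  rw [kernelBase_comm H r t b, kernelArg_comm H r t b, add_comm (b : ℂ)]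

/-- The radial variable lies in the closed dependence domain of the kernel. -/
def InCone (H r t b : ℝ) : Prop :=
  (H * r) ^ 2 ≤ (Real.exp (-(H * b)) - Real.exp (-(H * t))) ^ 2

theorem InCone.symm {H r t b : ℝ} (h : InCone H r t b) : InCone H r b t := by
  unfold InCone at *; linarith

theorem InCone.kernelBase_ge {H r t b : ℝ} (h : InCone H r t b) :
    4 * (Real.exp (-(H * b)) * Real.exp (-(H * t))) ≤ kernelBase H r t b := by
  unfold InCone at h; unfold kernelBase; linarith

theorem InCone.kernelBase_pos {H r t b : ℝ} (h : InCone H r t b) : 0 < kernelBase H r t b :=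
  lt_of_lt_of_le (by positivity) h.kernelBase_ge

theorem one_sub_kernelArg {H r t b : ℝ} (h : kernelBase H r t b ≠ 0) :
    1 - kernelArg H r t b
      = 4 * (Real.exp (-(H * b)) * Real.exp (-(H * t))) / kernelBase H r t b := by
  rw [kernelArg, eq_div_iff h, sub_mul, div_mul_cancel₀ _ h, kernelBase]
  ring

theorem InCone.kernelArg_mem {H r t b : ℝ} (h : InCone H r t b) :
    kernelArg H r t b ∈ Set.Ico (0 : ℝ) 1 := by
  have hB := h.kernelBase_pos
  have h1 := one_sub_kernelArg hB.ne'
  have h2 : 0 < 4 * (Real.exp (-(H * b)) * Real.exp (-(H * t))) / kernelBase H r t b := by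
    positivity
  refine ⟨div_nonneg ?_ hB.le, by linarith⟩
  unfold InCone at h
  linarith

theorem InCone.norm_kernelArg_lt {H r t b : ℝ} (h : InCone H r t b) :
    ‖(kernelArg H r t b : ℂ)‖ < 1 := by
  rw [Complex.norm_real, Real.norm_of_nonneg h.kernelArg_mem.1]
  exact h.kernelArg_mem.2

theorem hasDerivAt_exp_neg_mul (H b : ℝ) :
    HasDerivAt (fun b : ℝ => Real.exp (-(H * b))) (-(H * Real.exp (-(H * b)))) b := by
  have := (((hasDerivAt_id b).const_mul H).neg).exp
  simpa [mul_comm] using this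

theorem hasDerivAt_kernelBase (H r t b : ℝ) :
    HasDerivAt (fun b : ℝ => kernelBase H r t b) (kernelBaseDeriv H t b) b := by
  have := ((((hasDerivAt_exp_neg_mul H b).add_const (Real.exp (-(H * t)))).pow 2).sub_const
    ((H * r) ^ 2))
  refine this.congr_deriv ?_
  unfold kernelBaseDeriv
  push_cast
  ring

theorem hasDerivAt_kernelArg {H r t b : ℝ} (hB : kernelBase H r t b ≠ 0) :
    HasDerivAt (fun b : ℝ => kernelArg H r t b)
      ((1 - kernelArg H r t b) * (H + kernelBaseDeriv H t b / kernelBase H r t b)) b := by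
  have := ((((hasDerivAt_exp_neg_mul H b).const_add (-Real.exp (-(H * t)))).pow 2).sub_const
    ((r * H) ^ 2)).div (hasDerivAt_kernelBase H r t b) hB
  refine this.congr_deriv ?_
  rw [one_sub_kernelArg hB]
  have hB2 : (-Real.exp (-(H * t)) + Real.exp (-(H * b))) ^ 2 - (r * H) ^ 2
      = kernelBase H r t b - 4 * (Real.exp (-(H * b)) * Real.exp (-(H * t))) := by
    unfold kernelBase; ring
  simp only [Pi.pow_apply]
  rw [hB2]
  unfold kernelBaseDeriv
  field_simp
  push_cast
  ring

theorem re_half_sub {H : ℝ} (hH : 0 < H) {M : ℂ} (hM : 0 < M.re) :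
    (1 / 2 - M / (H : ℂ)).re < 1 / 2 := by
  have : (1 / 2 - M / (H : ℂ)).re = 1 / 2 - M.re / H := by
    rw [Complex.sub_re, Complex.div_ofReal_re]
    norm_num
  rw [this]
  have := div_pos hM hH
  linarith

theorem InCone.hasDerivAt_kernelE {H : ℝ} (hH : 0 < H) {M : ℂ} (hM : 0 < M.re) {r t b : ℝ}
    (h : InCone H r t b) :
    HasDerivAt (fun b : ℝ => kernelE H M r t b) (kernelEDeriv H M r t b) b := by
  have hB := h.kernelBase_pos
  have hB0 : (kernelBase H r t b : ℂ) ≠ 0 := by exact_mod_cast hB.ne'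
  have hF : HasDerivAt
      (ordinaryHypergeometric (1 / 2 - M / (H : ℂ)) (1 / 2 - M / (H : ℂ)) (1 : ℂ))
      (deriv (ordinaryHypergeometric (1 / 2 - M / (H : ℂ)) (1 / 2 - M / (H : ℂ)) (1 : ℂ))
        (kernelArg H r t b : ℂ)) (kernelArg H r t b : ℂ) :=
    ((differentiableOn_ordinaryHypergeometric (re_half_sub hH hM)).differentiableAt
      (Metric.isOpen_ball.mem_nhds (mem_ball_zero_iff.2 h.norm_kernelArg_lt))).hasDerivAt
  have h1 : HasDerivAt (fun b : ℝ => Complex.exp (M * ((b : ℂ) + (t : ℂ))))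
      (Complex.exp (M * ((b : ℂ) + (t : ℂ))) * M) b := by
    have := ((((hasDerivAt_id b).ofReal_comp).add_const (t : ℂ)).const_mul M).cexp
    simpa using this
  have h2 : HasDerivAt (fun b : ℝ => (kernelBase H r t b : ℂ) ^ (M / (H : ℂ) - 1 / 2))
      ((M / (H : ℂ) - 1 / 2) * (kernelBase H r t b : ℂ) ^ (M / (H : ℂ) - 1 / 2 - 1)
        * (kernelBaseDeriv H t b : ℂ)) b := by
    have hpow : HasDerivAt (fun w : ℂ => w ^ (M / (H : ℂ) - 1 / 2))
        ((M / (H : ℂ) - 1 / 2) * (kernelBase H r t b : ℂ) ^ (M / (H : ℂ) - 1 / 2 - 1))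
        (kernelBase H r t b : ℂ) := by
      simpa using (hasDerivAt_id (kernelBase H r t b : ℂ)).cpow_const
        (c := M / (H : ℂ) - 1 / 2) (Complex.ofReal_mem_slitPlane.2 hB)
    exact hpow.comp b (hasDerivAt_kernelBase H r t b).ofReal_comp
  have h3 := hF.comp b (hasDerivAt_kernelArg (r := r) (t := t) hB.ne').ofReal_comp
  refine (((h1.const_mul ((4 : ℂ) ^ (-(M / (H : ℂ))))).mul h2).mul h3).congr_deriv ?_
  rw [Complex.cpow_sub (M / (H : ℂ) - 1 / 2) 1 hB0, Complex.cpow_one]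
  unfold kernelEDeriv
  push_cast
  simp only [Pi.mul_apply, Function.comp_apply]
  ring

theorem norm_ofReal_cpow_half {H x : ℝ} (M : ℂ) (hx : 0 < x) :
    ‖(x : ℂ) ^ (M / (H : ℂ) - 1 / 2)‖ = x ^ (M.re / H - 1 / 2) := by
  rw [Complex.norm_cpow_eq_rpow_re_of_pos hx, Complex.sub_re, Complex.div_ofReal_re]
  norm_num

theorem norm_cexp_mul_add (M : ℂ) (b t : ℝ) :
    ‖Complex.exp (M * ((b : ℂ) + (t : ℂ)))‖ = Real.exp (M.re * (b + t)) := by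
  rw [Complex.norm_exp, ← Complex.ofReal_add, Complex.re_mul_ofReal]

theorem exists_norm_kernelE_le {H : ℝ} (hH : 0 < H) {M : ℂ} (hM : 0 < M.re) :
    ∃ C : ℝ, 0 < C ∧ ∀ r t b : ℝ, InCone H r t b →
      ‖kernelE H M r t b‖
        ≤ C * (Real.exp (M.re * (b + t)) * kernelBase H r t b ^ (M.re / H - 1 / 2)) := by
  obtain ⟨C, hC, hF⟩ := exists_norm_ordinaryHypergeometric_le (re_half_sub hH hM)
  refine ⟨‖(4 : ℂ) ^ (-(M / (H : ℂ)))‖ * C + 1, by positivity, fun r t b h => ?_⟩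
  have hB := h.kernelBase_pos
  have hP : 0 < Real.exp (M.re * (b + t)) * kernelBase H r t b ^ (M.re / H - 1 / 2) := by
    positivity
  unfold kernelE
  rw [norm_mul, norm_mul, norm_mul, norm_ofReal_cpow_half M hB, norm_cexp_mul_add]
  calc _ ≤ ‖(4 : ℂ) ^ (-(M / (H : ℂ)))‖ * Real.exp (M.re * (b + t))
        * kernelBase H r t b ^ (M.re / H - 1 / 2) * C := by
        gcongr
        exact hF _ h.norm_kernelArg_lt.le
    _ ≤ _ := by linarith

/-- The derivative of `F` blows up at most like `(1 - z)⁻¹`, which is compensated by the factor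
`1 - z` in the derivative of the argument; so differentiating costs only `kernelBase ⁻¹`. -/
theorem exists_norm_kernelEDeriv_le {H : ℝ} (hH : 0 < H) {M : ℂ} (hM : 0 < M.re) :
    ∃ C : ℝ, 0 < C ∧ ∀ r t b : ℝ, InCone H r t b →
      ‖kernelEDeriv H M r t b‖
        ≤ C * (Real.exp (M.re * (b + t)) * kernelBase H r t b ^ (M.re / H - 3 / 2)
          * (Real.exp (-(H * b)) + Real.exp (-(H * t))) ^ 2) := by
  obtain ⟨C, hC, hF⟩ := exists_norm_ordinaryHypergeometric_le (re_half_sub hH hM)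
  obtain ⟨C', hC', hF'⟩ := exists_norm_deriv_ordinaryHypergeometric_le (re_half_sub hH hM)
  refine ⟨‖(4 : ℂ) ^ (-(M / (H : ℂ)))‖
    * ((‖M‖ + ‖M / (H : ℂ) - 1 / 2‖ * (2 * H)) * C + 3 * H * C') + 1, by positivity,
    fun r t b h => ?_⟩
  have hB := h.kernelBase_pos
  have hz := h.kernelArg_mem
  set F : ℂ → ℂ := ordinaryHypergeometric (1 / 2 - M / (H : ℂ)) (1 / 2 - M / (H : ℂ)) (1 : ℂ)
  set B := kernelBase H r t b with hBdef
  set z := kernelArg H r t b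
  set S := Real.exp (-(H * b)) + Real.exp (-(H * t)) with hS
  have hX := Real.exp_pos (-(H * b))
  have hY := Real.exp_pos (-(H * t))
  -- `1 ≤ S ^ 2 / B` absorbs the terms in which the power of the base is not lowered.
  have hBS : 1 ≤ S ^ 2 / B := by
    rw [le_div_iff₀ hB, hBdef, kernelBase, ← hS]
    nlinarith [sq_nonneg (H * r)]
  have hd : |kernelBaseDeriv H t b / B| ≤ 2 * H * (S ^ 2 / B) := by
    rw [abs_div, abs_of_pos hB, mul_div_assoc']
    gcongr
    rw [kernelBaseDeriv, abs_neg, abs_of_pos (by positivity), ← hS, mul_assoc, sq]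
    gcongr
    linarith
  have hz1 := hF (z : ℂ) h.norm_kernelArg_lt.le
  have hz2 := hF' (z : ℂ) h.norm_kernelArg_lt
  rw [Complex.norm_real, Real.norm_of_nonneg hz.1] at hz2
  have h1z : 0 < 1 - z := by linarith [hz.2]
  have hA : ‖(M + (M / (H : ℂ) - 1 / 2) * (kernelBaseDeriv H t b / B : ℝ)) * F (z : ℂ)‖
      ≤ (‖M‖ + ‖M / (H : ℂ) - 1 / 2‖ * (2 * H)) * C * (S ^ 2 / B) := by
    rw [norm_mul]
    have : ‖M + (M / (H : ℂ) - 1 / 2) * (kernelBaseDeriv H t b / B : ℝ)‖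
        ≤ (‖M‖ + ‖M / (H : ℂ) - 1 / 2‖ * (2 * H)) * (S ^ 2 / B) := by
      refine (norm_add_le _ _).trans ?_
      rw [norm_mul, Complex.norm_real, Real.norm_eq_abs, add_mul]
      have h1 := le_mul_of_one_le_right (norm_nonneg M) hBS
      have h2 := mul_le_mul_of_nonneg_left hd (norm_nonneg (M / (H : ℂ) - 1 / 2))
      linarith
    calc _ ≤ ((‖M‖ + ‖M / (H : ℂ) - 1 / 2‖ * (2 * H)) * (S ^ 2 / B)) * C :=
          mul_le_mul this hz1 (norm_nonneg _) (by positivity)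
      _ = _ := by ring
  have hD : ‖((1 - z) * (H + kernelBaseDeriv H t b / B) : ℝ) * deriv F (z : ℂ)‖
      ≤ 3 * H * C' * (S ^ 2 / B) := by
    rw [norm_mul, Complex.norm_real, Real.norm_eq_abs, abs_mul, abs_of_pos h1z]
    have : |H + kernelBaseDeriv H t b / B| ≤ 3 * H * (S ^ 2 / B) := by
      refine (abs_add_le _ _).trans ?_
      rw [abs_of_pos hH]
      have := le_mul_of_one_le_right hH.le hBS
      linarith
    calc _ = |H + kernelBaseDeriv H t b / B| * ((1 - z) * ‖deriv F (z : ℂ)‖) := by ring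
      _ ≤ 3 * H * (S ^ 2 / B) * C' := mul_le_mul this hz2 (by positivity) (by positivity)
      _ = _ := by ring
  have hpow : B ^ (M.re / H - 1 / 2) = B ^ (M.re / H - 3 / 2) * B := by
    rw [← Real.rpow_add_one hB.ne']
    congr 1
    ring
  unfold kernelEDeriv
  rw [norm_mul, norm_mul, norm_mul, norm_ofReal_cpow_half M hB, norm_cexp_mul_add]
  calc _ ≤ ‖(4 : ℂ) ^ (-(M / (H : ℂ)))‖ * Real.exp (M.re * (b + t))
        * B ^ (M.re / H - 1 / 2)
        * ((‖M‖ + ‖M / (H : ℂ) - 1 / 2‖ * (2 * H)) * C * (S ^ 2 / B)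
          + 3 * H * C' * (S ^ 2 / B)) := by
        gcongr
        exact (norm_add_le _ _).trans (add_le_add hA hD)
    _ = (‖(4 : ℂ) ^ (-(M / (H : ℂ)))‖
        * ((‖M‖ + ‖M / (H : ℂ) - 1 / 2‖ * (2 * H)) * C + 3 * H * C'))
        * (Real.exp (M.re * (b + t)) * B ^ (M.re / H - 3 / 2) * S ^ 2) := by
        rw [hpow]
        field_simp
    _ ≤ _ := by
        have : 0 < Real.exp (M.re * (b + t)) * B ^ (M.re / H - 3 / 2) * S ^ 2 := by positivity
        linarith

theorem continuous_kernelBase (H t b : ℝ) : Continuous fun r => kernelBase H r t b := by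
  unfold kernelBase; fun_prop

theorem continuousOn_kernelArg (H t b : ℝ) :
    ContinuousOn (fun r => kernelArg H r t b) {r | InCone H r t b} := by
  unfold kernelArg
  exact ContinuousOn.div (by fun_prop) (continuous_kernelBase H t b).continuousOn
    fun r hr => (InCone.kernelBase_pos hr).ne'

theorem continuousOn_kernelBase_cpow (H t b : ℝ) (v : ℂ) :
    ContinuousOn (fun r => (kernelBase H r t b : ℂ) ^ v) {r | InCone H r t b} :=
  ContinuousOn.cpow_const
    (Complex.continuous_ofReal.comp (continuous_kernelBase H t b)).continuousOn
    fun _ hr => Complex.ofReal_mem_slitPlane.2 (InCone.kernelBase_pos hr)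

theorem continuousOn_comp_kernelArg {f : ℂ → ℂ} (hf : ContinuousOn f (Metric.ball 0 1))
    (H t b : ℝ) : ContinuousOn (fun r => f (kernelArg H r t b : ℂ)) {r | InCone H r t b} :=
  hf.comp (Complex.continuous_ofReal.comp_continuousOn (continuousOn_kernelArg H t b))
    fun _ hr => mem_ball_zero_iff.2 (InCone.norm_kernelArg_lt hr)

theorem continuousOn_kernelE {H : ℝ} (hH : 0 < H) {M : ℂ} (hM : 0 < M.re) (t b : ℝ) :
    ContinuousOn (fun r => kernelE H M r t b) {r | InCone H r t b} :=
  (continuousOn_const.mul (continuousOn_kernelBase_cpow H t b _)).mul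
    (continuousOn_comp_kernelArg
      (differentiableOn_ordinaryHypergeometric (re_half_sub hH hM)).continuousOn H t b)

theorem continuousOn_kernelEDeriv {H : ℝ} (hH : 0 < H) {M : ℂ} (hM : 0 < M.re) (t b : ℝ) :
    ContinuousOn (fun r => kernelEDeriv H M r t b) {r | InCone H r t b} := by
  have hF := differentiableOn_ordinaryHypergeometric (re_half_sub hH hM)
  have hq : ContinuousOn (fun r => kernelBaseDeriv H t b / kernelBase H r t b)
      {r | InCone H r t b} :=
    continuousOn_const.div (continuous_kernelBase H t b).continuousOn
      fun r hr => (InCone.kernelBase_pos hr).ne'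
  have hz := continuousOn_kernelArg H t b
  refine (continuousOn_const.mul (continuousOn_kernelBase_cpow H t b _)).mul
    (((continuousOn_const.add (continuousOn_const.mul
      (Complex.continuous_ofReal.comp_continuousOn hq))).mul
        (continuousOn_comp_kernelArg hF.continuousOn H t b)).add
      ((Complex.continuous_ofReal.comp_continuousOn
        ((continuousOn_const.sub hz).mul (continuousOn_const.add hq))).mul
        (continuousOn_comp_kernelArg (hF.deriv Metric.isOpen_ball).continuousOn H t b)))

/-! ### Scaling of the radial variable -/

theorem inCone_scaled {H : ℝ} (hH : 0 < H) (t b : ℝ) {s : ℝ} (hs : s ∈ Set.Icc (0 : ℝ) 1) :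
    InCone H ((Real.exp (-(H * b)) - Real.exp (-(H * t))) / H * s) t b := by
  unfold InCone
  have : H * ((Real.exp (-(H * b)) - Real.exp (-(H * t))) / H * s)
      = (Real.exp (-(H * b)) - Real.exp (-(H * t))) * s := by field_simp
  rw [this, mul_pow]
  exact mul_le_of_le_one_right (sq_nonneg _) (pow_le_one₀ hs.1 hs.2)

theorem kernelBase_scaled {H : ℝ} (hH : 0 < H) (t b s : ℝ) :
    kernelBase H ((Real.exp (-(H * b)) - Real.exp (-(H * t))) / H * s) t b
      = Real.exp (-(H * b)) ^ 2 * scaledBase (Real.exp (-(H * (t - b)))) s := by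
  have hY : Real.exp (-(H * t)) = Real.exp (-(H * b)) * Real.exp (-(H * (t - b))) := by
    rw [← Real.exp_add]; ring_nf
  unfold kernelBase scaledBase
  rw [hY]
  field_simp

theorem kernelBase_scaled_rpow {H : ℝ} (hH : 0 < H) (t b : ℝ) {s : ℝ}
    (hs : s ∈ Set.Icc (0 : ℝ) 1) (p : ℝ) :
    kernelBase H ((Real.exp (-(H * b)) - Real.exp (-(H * t))) / H * s) t b ^ p
      = Real.exp (-(2 * H * b * p)) * scaledBase (Real.exp (-(H * (t - b)))) s ^ p := by
  rw [kernelBase_scaled hH, Real.mul_rpow (by positivity)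
    (scaledBase_pos (Real.exp_pos _) hs).le, ← Real.exp_nat_mul, ← Real.exp_mul]
  congr 2
  push_cast
  ring

/-- By homogeneity the bound depends on `t - b` only, up to the factor `e^{Hb}`. -/
theorem exists_norm_kernelEDeriv_scaled_le {H : ℝ} (hH : 0 < H) {M : ℂ} (hM : 0 < M.re) :
    ∃ C : ℝ, 0 < C ∧ ∀ t b : ℝ, b < t → ∀ s ∈ Set.Icc (0 : ℝ) 1,
      ‖kernelEDeriv H M ((Real.exp (-(H * b)) - Real.exp (-(H * t))) / H * s) t b‖
          ≤ C * Real.exp (M.re * (t - b)) * Real.exp (H * b)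
            * scaledBase (Real.exp (-(H * (t - b)))) s ^ (M.re / H - 3 / 2) ∧
      ‖kernelEDeriv H M ((Real.exp (-(H * b)) - Real.exp (-(H * t))) / H * s) b t‖
          ≤ C * Real.exp (M.re * (t - b)) * Real.exp (H * b)
            * scaledBase (Real.exp (-(H * (t - b)))) s ^ (M.re / H - 3 / 2) := by
  obtain ⟨C, hC, hb⟩ := exists_norm_kernelEDeriv_le hH hM
  refine ⟨4 * C, by positivity, fun t b hbt s hs => ?_⟩
  have hcone := inCone_scaled hH t b hs
  have h1 := hb _ t b hcone
  have h2 := hb _ b t hcone.symm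
  rw [kernelBase_comm, add_comm t b, add_comm (Real.exp (-(H * t)))] at h2
  have hXY : Real.exp (-(H * t)) ≤ Real.exp (-(H * b)) := Real.exp_le_exp.2 (by nlinarith)
  have hS : (Real.exp (-(H * b)) + Real.exp (-(H * t))) ^ 2 ≤ 4 * Real.exp (-(2 * H * b)) := by
    have : Real.exp (-(2 * H * b)) = Real.exp (-(H * b)) * Real.exp (-(H * b)) := by
      rw [← Real.exp_add]; ring_nf
    rw [this]
    nlinarith [Real.exp_pos (-(H * t)), Real.exp_pos (-(H * b))]
  have hβ := Real.rpow_nonneg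
    (scaledBase_pos (Real.exp_pos (-(H * (t - b)))) hs).le (M.re / H - 3 / 2)
  have key : C * (Real.exp (M.re * (b + t))
      * kernelBase H ((Real.exp (-(H * b)) - Real.exp (-(H * t))) / H * s) t b
        ^ (M.re / H - 3 / 2) * (Real.exp (-(H * b)) + Real.exp (-(H * t))) ^ 2)
      ≤ 4 * C * Real.exp (M.re * (t - b)) * Real.exp (H * b)
            * scaledBase (Real.exp (-(H * (t - b)))) s ^ (M.re / H - 3 / 2) := by
    rw [kernelBase_scaled_rpow hH t b hs]
    set β := scaledBase (Real.exp (-(H * (t - b)))) s ^ (M.re / H - 3 / 2)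
    calc _ ≤ C * (Real.exp (M.re * (b + t))
          * (Real.exp (-(2 * H * b * (M.re / H - 3 / 2))) * β)
          * (4 * Real.exp (-(2 * H * b)))) := by gcongr
      _ = 4 * C * (Real.exp (M.re * (b + t)) * Real.exp (-(2 * H * b * (M.re / H - 3 / 2)))
          * Real.exp (-(2 * H * b))) * β := by ring
      _ = 4 * C * (Real.exp (M.re * (t - b)) * Real.exp (H * b)) * β := by
          rw [← Real.exp_add, ← Real.exp_add, ← Real.exp_add]
          congr 3
          field_simp
          ring
      _ = _ := by ring
  exact ⟨h1.trans key, h2.trans key⟩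

theorem phi_eq (H t : ℝ) : phi H t = (Real.exp (-(H * 0)) - Real.exp (-(H * t))) / H := by
  simp [phi]

theorem phi_pos {H t : ℝ} (hH : 0 < H) (ht : 0 < t) : 0 < phi H t :=
  div_pos (sub_pos.2 (Real.exp_lt_one_iff.2 (by nlinarith))) hH

/-- A pointwise bound for a kernel in terms of a power of the scaled base gives a bound for its
weighted integral. -/
theorem weighted_integral_le {H a p : ℝ} (hH : 0 < H) (ha : -1 < a) (hp : p ≠ -1) :
    ∃ C : ℝ, 0 < C ∧ ∀ (K : ℝ → ℝ → ℂ) (A t : ℝ), 0 < t → 0 ≤ A →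
      ContinuousOn (fun s => K (phi H t * s) t) (Set.Icc 0 1) →
      (∀ s ∈ Set.Icc (0 : ℝ) 1,
        ‖K (phi H t * s) t‖ ≤ A * scaledBase (Real.exp (-(H * t))) s ^ p) →
      IntervalIntegrable (weighted H a K t) volume 0 1 ∧
      ∫ s in (0 : ℝ)..1, weighted H a K t s
        ≤ C * A * (1 - Real.exp (-(H * t))) ^ (a + 1)
          * Real.exp (-(H * t)) ^ min (p + 1) 0 := by
  obtain ⟨C, hC, hI⟩ := integral_rpow_mul_scaledBase_rpow_le ha hp
  refine ⟨C / H ^ (a + 1), by positivity, fun K A t ht hA hcont hle => ?_⟩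
  have hphi := phi_pos hH ht
  have hq := Real.exp_pos (-(H * t))
  have hq1 : Real.exp (-(H * t)) ≤ 1 := (Real.exp_lt_one_iff.2 (by nlinarith)).le
  have hw : weighted H a K t
      = fun s => phi H t ^ (a + 1) * (s ^ a * ‖K (phi H t * s) t‖) := by
    funext s
    rw [weighted, Real.rpow_add_one hphi.ne']
    ring
  have hint : IntervalIntegrable (weighted H a K t) volume 0 1 := by
    rw [hw]
    exact (intervalIntegrable_rpow_mul ha hcont.norm).const_mul _
  refine ⟨hint, ?_⟩
  calc ∫ s in (0 : ℝ)..1, weighted H a K t s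
      ≤ ∫ s in (0 : ℝ)..1, phi H t ^ (a + 1) * A
          * (s ^ a * scaledBase (Real.exp (-(H * t))) s ^ p) := by
        refine intervalIntegral.integral_mono_on zero_le_one hint
          ((intervalIntegrable_rpow_mul ha (continuousOn_scaledBase_rpow hq p)).const_mul _)
          fun s hs => ?_
        rw [hw]
        have h1 := mul_le_mul_of_nonneg_left (hle s hs)
          (mul_nonneg (Real.rpow_nonneg hphi.le (a + 1)) (Real.rpow_nonneg hs.1 a))
        calc _ = phi H t ^ (a + 1) * s ^ a * ‖K (phi H t * s) t‖ := by ring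
          _ ≤ _ := h1
          _ = _ := by ring
    _ = phi H t ^ (a + 1) * A
          * ∫ s in (0 : ℝ)..1, s ^ a * scaledBase (Real.exp (-(H * t))) s ^ p :=
        intervalIntegral.integral_const_mul _ _
    _ ≤ phi H t ^ (a + 1) * A * (C * Real.exp (-(H * t)) ^ min (p + 1) 0) := by
        gcongr
        exact hI _ hq hq1
    _ = _ := by
        rw [phi, Real.div_rpow (by linarith) hH.le]
        ring

/-! ### Integral bounds -/

theorem InCone.differentiableAt_kernelE {H : ℝ} (hH : 0 < H) {M : ℂ} (hM : 0 < M.re) {r t b : ℝ}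
    (h : InCone H r t b) : DifferentiableAt ℝ (fun b : ℝ => kernelE H M r t b) b :=
  (h.hasDerivAt_kernelE hH hM).differentiableAt

theorem InCone.hasDerivAt_kernelE_time {H : ℝ} (hH : 0 < H) {M : ℂ} (hM : 0 < M.re) {r t b : ℝ}
    (h : InCone H r t b) :
    HasDerivAt (fun τ : ℝ => kernelE H M r τ b) (kernelEDeriv H M r b t) t := by
  simp_rw [fun τ => kernelE_comm H M r τ b]
  exact h.symm.hasDerivAt_kernelE hH hM

theorem inCone_of_mem_Icc {H t b r : ℝ} (hH : 0 < H)
    (hr : r ∈ Set.Icc 0 ((Real.exp (-(H * b)) - Real.exp (-(H * t))) / H)) :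
    InCone H r t b := by
  have h1 : H * r ≤ Real.exp (-(H * b)) - Real.exp (-(H * t)) := by
    have := hr.2
    rw [le_div_iff₀ hH] at this
    linarith
  exact pow_le_pow_left₀ (mul_nonneg hH.le hr.1) h1 2

theorem continuousOn_scaled {H : ℝ} (hH : 0 < H) {t b : ℝ} {f : ℝ → ℂ}
    (hf : ContinuousOn f {r | InCone H r t b}) :
    ContinuousOn (fun s => f ((Real.exp (-(H * b)) - Real.exp (-(H * t))) / H * s))
      (Set.Icc 0 1) :=
  hf.comp (by fun_prop) fun _ hs => inCone_scaled hH t b hs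

theorem weighted_kernelK1_le {H : ℝ} (hH : 0 < H) {M : ℂ} (hM : 0 < M.re) {a : ℝ} (ha : -1 < a) :
    ∃ C : ℝ, 0 < C ∧ ∀ t : ℝ, 0 < t →
      IntervalIntegrable (weighted H a (kernelK1 H M) t) volume 0 1 ∧
      ∫ s in (0 : ℝ)..1, weighted H a (kernelK1 H M) t s
        ≤ C * ((1 - Real.exp (-(H * t))) ^ (a + 1) * Real.exp (M.re * t)) := by
  have hm := div_pos hM hH
  obtain ⟨C, hC, hw⟩ := weighted_integral_le (p := M.re / H - 1 / 2) hH ha (by linarith)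
  obtain ⟨C', hC', hE⟩ := exists_norm_kernelE_le hH hM
  refine ⟨C * C', by positivity, fun t ht => ?_⟩
  have := hw (kernelK1 H M) (C' * Real.exp (M.re * t)) t ht (by positivity) ?_ fun s hs => ?_
  · refine ⟨this.1, this.2.trans_eq ?_⟩
    rw [min_eq_right (by linarith), Real.rpow_zero]
    ring
  · rw [phi_eq]
    exact continuousOn_scaled hH (continuousOn_kernelE hH hM t 0)
  · rw [phi_eq]
    have h1 := hE _ t 0 (inCone_scaled hH t 0 hs)
    rw [kernelBase_scaled_rpow hH t 0 hs] at h1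
    refine h1.trans_eq ?_
    simp
    ring

theorem div_sub_ne_neg_one {H μ : ℝ} (hH : 0 < H) (hne : μ ≠ H / 2) : μ / H - 3 / 2 ≠ -1 := by
  intro h
  have : μ / H = 1 / 2 := by linarith
  rw [div_eq_iff hH.ne'] at this
  exact hne (by linarith)

/-- The growth rate of the differentiated kernels: `q^{μ/H - 1/2}` turns `e^{μx}` into `e^{Hx/2}`
when `μ ≤ H / 2`. -/
theorem exp_rpow_min (H μ x : ℝ) (hH : 0 < H) :
    Real.exp (μ * x) * Real.exp (-(H * x)) ^ min (μ / H - 3 / 2 + 1) 0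
      = Real.exp (max μ (H / 2) * x) := by
  rw [← Real.exp_mul, ← Real.exp_add]
  congr 1
  rcases le_total μ (H / 2) with h | h
  · have : μ / H ≤ 1 / 2 := by rw [div_le_iff₀ hH]; linarith
    rw [max_eq_right h, min_eq_left (by linarith)]
    field_simp
    ring
  · have : 1 / 2 ≤ μ / H := by rw [le_div_iff₀ hH]; linarith
    rw [max_eq_left h, min_eq_right (by linarith)]
    ring

theorem weighted_kernelK0_le {H : ℝ} (hH : 0 < H) {M : ℂ} (hM : 0 < M.re)
    (hne : M.re ≠ H / 2) {a : ℝ} (ha : -1 < a) :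
    ∃ C : ℝ, 0 < C ∧ ∀ t : ℝ, 0 < t →
      IntervalIntegrable (weighted H a (kernelK0 H M) t) volume 0 1 ∧
      ∫ s in (0 : ℝ)..1, weighted H a (kernelK0 H M) t s
        ≤ C * ((1 - Real.exp (-(H * t))) ^ (a + 1) * Real.exp (max M.re (H / 2) * t)) := by
  have hp := div_sub_ne_neg_one hH hne
  obtain ⟨C, hC, hw⟩ := weighted_integral_le hH ha hp
  obtain ⟨C', hC', hE⟩ := exists_norm_kernelEDeriv_scaled_le hH hM
  refine ⟨C * C', by positivity, fun t ht => ?_⟩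
  have hK : ∀ s ∈ Set.Icc (0 : ℝ) 1, kernelK0 H M (phi H t * s) t
      = -kernelEDeriv H M ((Real.exp (-(H * 0)) - Real.exp (-(H * t))) / H * s) t 0 := by
    intro s hs
    rw [phi_eq, kernelK0, ((inCone_scaled hH t 0 hs).hasDerivAt_kernelE hH hM).deriv]
  have := hw (kernelK0 H M) (C' * Real.exp (M.re * t)) t ht (by positivity) ?_ fun s hs => ?_
  · refine ⟨this.1, this.2.trans_eq ?_⟩
    rw [← exp_rpow_min H M.re t hH]
    ring
  · exact (continuousOn_scaled hH (continuousOn_kernelEDeriv hH hM t 0)).neg.congr hK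
  · rw [hK s hs, norm_neg]
    simpa using (hE t 0 ht s hs).1

theorem integral_kernelEt_le {H : ℝ} (hH : 0 < H) {M : ℂ} (hM : 0 < M.re)
    (hne : M.re ≠ H / 2) :
    ∃ C : ℝ, 0 < C ∧ ∀ t b : ℝ, b < t →
      IntervalIntegrable (fun r : ℝ => ‖kernelEt H M r t b‖) volume
        0 ((Real.exp (-(H * b)) - Real.exp (-(H * t))) / H) ∧
      ∫ r in (0 : ℝ)..((Real.exp (-(H * b)) - Real.exp (-(H * t))) / H), ‖kernelEt H M r t b‖
        ≤ C * Real.exp (max M.re (H / 2) * (t - b)) := by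
  have hp := div_sub_ne_neg_one hH hne
  obtain ⟨C, hC, hI⟩ := integral_rpow_mul_scaledBase_rpow_le (a := 0) (by norm_num) hp
  obtain ⟨C', hC', hE⟩ := exists_norm_kernelEDeriv_scaled_le hH hM
  refine ⟨C * C' / H, by positivity, fun t b hbt => ?_⟩
  set L := (Real.exp (-(H * b)) - Real.exp (-(H * t))) / H with hL
  set q := Real.exp (-(H * (t - b))) with hq
  have hq0 : 0 < q := Real.exp_pos _
  have hq1 : q ≤ 1 := (Real.exp_lt_one_iff.2 (by nlinarith)).le
  have hL0 : 0 < L := div_pos (sub_pos.2 (Real.exp_lt_exp.2 (by nlinarith))) hH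
  have hK : ∀ r ∈ Set.Icc 0 L, ‖kernelEt H M r t b‖ = ‖kernelEDeriv H M r b t‖ := by
    intro r hr
    rw [kernelEt, ((inCone_of_mem_Icc hH hr).hasDerivAt_kernelE_time hH hM).deriv]
  have hcont : ContinuousOn (fun r => ‖kernelEt H M r t b‖) (Set.Icc 0 L) :=
    ((continuousOn_kernelEDeriv hH hM b t).mono
      fun r hr => (inCone_of_mem_Icc hH hr).symm).norm.congr hK
  have hmaps : Set.MapsTo (fun s => L * s) (Set.Icc 0 1) (Set.Icc 0 L) := fun s hs =>
    ⟨mul_nonneg hL0.le hs.1, mul_le_of_le_one_right hL0.le hs.2⟩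
  refine ⟨ContinuousOn.intervalIntegrable (by rwa [Set.uIcc_of_le hL0.le]), ?_⟩
  have hsub : ∫ r in (0 : ℝ)..L, ‖kernelEt H M r t b‖
      = L * ∫ s in (0 : ℝ)..1, ‖kernelEt H M (L * s) t b‖ := by
    rw [intervalIntegral.mul_integral_comp_mul_left (f := fun r => ‖kernelEt H M r t b‖),
      mul_zero, mul_one]
  have hpow : ContinuousOn (fun s => s ^ (0 : ℝ) * scaledBase q s ^ (M.re / H - 3 / 2))
      (Set.uIcc 0 1) := by
    simp only [Real.rpow_zero, one_mul]
    rw [Set.uIcc_of_le zero_le_one]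
    exact continuousOn_scaledBase_rpow hq0 _
  have hLX : L * Real.exp (H * b) ≤ 1 / H := by
    rw [hL, div_mul_eq_mul_div, sub_mul, ← Real.exp_add, ← Real.exp_add]
    gcongr
    have := Real.exp_pos (-(H * t) + H * b)
    simp only [neg_add_cancel, Real.exp_zero]
    linarith
  rw [hsub, ← exp_rpow_min H M.re (t - b) hH]
  calc L * ∫ s in (0 : ℝ)..1, ‖kernelEt H M (L * s) t b‖
      ≤ L * ∫ s in (0 : ℝ)..1, C' * Real.exp (M.re * (t - b)) * Real.exp (H * b)
          * (s ^ (0 : ℝ) * scaledBase q s ^ (M.re / H - 3 / 2)) := by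
        gcongr
        refine intervalIntegral.integral_mono_on zero_le_one
          (ContinuousOn.intervalIntegrable ?_) (hpow.intervalIntegrable.const_mul _)
          fun s hs => ?_
        · rw [Set.uIcc_of_le zero_le_one]
          exact hcont.comp (by fun_prop) hmaps
        · rw [hK _ (hmaps hs), Real.rpow_zero, one_mul]
          exact (hE t b hbt s hs).2
    _ = C' * Real.exp (M.re * (t - b)) * (L * Real.exp (H * b))
          * ∫ s in (0 : ℝ)..1, s ^ (0 : ℝ) * scaledBase q s ^ (M.re / H - 3 / 2) := by
        rw [intervalIntegral.integral_const_mul]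
        ring
    _ ≤ C' * Real.exp (M.re * (t - b)) * (1 / H)
          * (C * q ^ min (M.re / H - 3 / 2 + 1) 0) := by
        have h0 : 0 ≤ ∫ s in (0 : ℝ)..1, s ^ (0 : ℝ) * scaledBase q s ^ (M.re / H - 3 / 2) :=
          intervalIntegral.integral_nonneg zero_le_one fun s hs =>
            mul_nonneg (Real.rpow_nonneg hs.1 _)
              (Real.rpow_nonneg (scaledBase_pos hq0 hs).le _)
        exact mul_le_mul (by gcongr) (hI q hq0 hq1) h0 (by positivity)
    _ = _ := by ring

theorem exp_mul_le_two_mul_rpow {x σ : ℝ} (hx : 0 ≤ x) (hσ : -1 ≤ σ) :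
    Real.exp (σ * x) ≤ 2 * (Real.exp x + 1) ^ σ := by
  have hx1 := Real.one_le_exp hx
  have e1 : Real.exp x + 1 = Real.exp x * (1 + Real.exp (-x)) := by
    rw [mul_add, ← Real.exp_add]; simp
  have h0 := Real.exp_pos (-x)
  have h2 : Real.exp (-x) ≤ 1 := Real.exp_le_one_iff.2 (by linarith)
  have h3 : (1 / 2 : ℝ) ≤ (1 + Real.exp (-x)) ^ σ := by
    calc (1 / 2 : ℝ) ≤ (1 + Real.exp (-x))⁻¹ := by
          rw [one_div]; exact inv_anti₀ (by linarith) (by linarith)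
      _ = (1 + Real.exp (-x)) ^ (-1 : ℝ) := (Real.rpow_neg_one _).symm
      _ ≤ _ := Real.rpow_le_rpow_of_exponent_le (by linarith) hσ
  rw [e1, Real.mul_rpow (by positivity) (by positivity), ← Real.exp_mul, mul_comm x]
  nlinarith [Real.exp_pos (σ * x)]

theorem one_sub_exp_neg_rpow {H t : ℝ} (hH : 0 < H) (ht : 0 < t) (a : ℝ) :
    (1 - Real.exp (-(H * t))) ^ (a + 1)
      = Real.exp (-(a * H * t)) * (Real.exp (H * t) - 1) ^ (a + 1) * Real.exp (-(H * t)) := by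
  have h1 : 0 ≤ 1 - Real.exp (-(H * t)) := sub_nonneg.2 (Real.exp_lt_one_iff.2 (by nlinarith)).le
  have e1 : Real.exp (H * t) - 1 = Real.exp (H * t) * (1 - Real.exp (-(H * t))) := by
    rw [mul_sub, ← Real.exp_add]; simp
  rw [e1, Real.mul_rpow (by positivity) h1, ← Real.exp_mul]
  have : Real.exp (-(a * H * t)) * Real.exp (H * t * (a + 1)) * Real.exp (-(H * t)) = 1 := by
    rw [← Real.exp_add, ← Real.exp_add, Real.exp_eq_one_iff]
    ring
  linear_combination -(1 - Real.exp (-(H * t))) ^ (a + 1) * this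

theorem one_sub_exp_neg_rpow_le_one {H t a : ℝ} (hH : 0 < H) (ht : 0 < t) (ha : -1 < a) :
    (1 - Real.exp (-(H * t))) ^ (a + 1) ≤ 1 :=
  Real.rpow_le_one (sub_nonneg.2 (Real.exp_lt_one_iff.2 (by nlinarith)).le)
    (by linarith [Real.exp_pos (-(H * t))]) (by linarith)

/-- Both claims about a weighted integral, the bound for all times in the form `W` and the growth
for large times, follow from a bound by `(1 - e^{-Ht})^{a+1} e^{κt}`. -/
theorem weighted_bounds_of_le {H a κ : ℝ} (hH : 0 < H) (ha : -1 < a) {K : ℝ → ℝ → ℂ}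
    {W : ℝ → ℝ}
    (hK : ∃ C : ℝ, 0 < C ∧ ∀ t : ℝ, 0 < t →
      IntervalIntegrable (weighted H a K t) volume 0 1 ∧
      ∫ s in (0 : ℝ)..1, weighted H a K t s
        ≤ C * ((1 - Real.exp (-(H * t))) ^ (a + 1) * Real.exp (κ * t)))
    (hW : ∀ t : ℝ, 0 < t →
      (1 - Real.exp (-(H * t))) ^ (a + 1) * Real.exp (κ * t) ≤ 2 * W t) :
    (∃ C : ℝ, 0 < C ∧ ∀ t : ℝ, 0 < t →
      IntervalIntegrable (weighted H a K t) volume 0 1 ∧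
      ∫ s in (0 : ℝ)..1, weighted H a K t s ≤ C * W t) ∧
    (∃ C : ℝ, 0 < C ∧ ∀ᶠ t : ℝ in atTop,
      ∫ s in (0 : ℝ)..1, weighted H a K t s ≤ C * Real.exp (κ * t)) := by
  obtain ⟨C, hC, h⟩ := hK
  refine ⟨⟨C * 2, by positivity, fun t ht => ⟨(h t ht).1, (h t ht).2.trans ?_⟩⟩,
    ⟨C, hC, ?_⟩⟩
  · rw [mul_assoc]
    exact mul_le_mul_of_nonneg_left (hW t ht) hC.le
  · filter_upwards [eventually_gt_atTop (0 : ℝ)] with t ht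
    refine (h t ht).2.trans (mul_le_mul_of_nonneg_left ?_ hC.le)
    exact mul_le_of_le_one_left (Real.exp_pos _).le (one_sub_exp_neg_rpow_le_one hH ht ha)

/-- Comparison of the exponential form of a weight with its form in `e^{Ht} + 1`. -/
theorem one_sub_exp_neg_rpow_mul_le {H t σ κ : ℝ} (hH : 0 < H) (ht : 0 < t) (hσ : -1 ≤ σ)
    (hκ : κ = H * (σ + 1)) (a : ℝ) :
    (1 - Real.exp (-(H * t))) ^ (a + 1) * Real.exp (κ * t)
      ≤ 2 * (Real.exp (-(a * H * t)) * (Real.exp (H * t) - 1) ^ (a + 1)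
        * (Real.exp (H * t) + 1) ^ σ) := by
  have h1 := exp_mul_le_two_mul_rpow (x := H * t) (by positivity) hσ
  have h2 : Real.exp (σ * (H * t)) = Real.exp (-(H * t)) * Real.exp (κ * t) := by
    rw [← Real.exp_add, hκ]; ring_nf
  have h3 : 0 ≤ Real.exp (-(a * H * t)) * (Real.exp (H * t) - 1) ^ (a + 1) :=
    mul_nonneg (Real.exp_pos _).le
      (Real.rpow_nonneg (sub_nonneg.2 (Real.one_le_exp (by positivity))) _)
  rw [one_sub_exp_neg_rpow hH ht, mul_assoc _ (Real.exp (-(H * t))), ← h2]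
  calc _ ≤ _ := mul_le_mul_of_nonneg_left h1 h3
    _ = _ := by ring

end DeSitter

theorem mainTheorem9 (H : ℝ) (hH : 0 < H) (M : ℂ) (hM : 0 < M.re) :
    -- weighted bounds for `K₁`
    (∀ a : ℝ, -1 < a →
      (∃ C : ℝ, 0 < C ∧ ∀ t : ℝ, 0 < t →
        IntervalIntegrable (DeSitter.weighted H a (DeSitter.kernelK1 H M) t) volume 0 1 ∧
        ∫ s in (0 : ℝ)..1, DeSitter.weighted H a (DeSitter.kernelK1 H M) t s
          ≤ C * (Real.exp (-(a * H * t)) * (Real.exp (H * t) - 1) ^ (a + 1)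
              * (Real.exp (H * t) + 1) ^ (M.re / H - 1))) ∧
      (∃ C : ℝ, 0 < C ∧ ∀ᶠ t : ℝ in atTop,
        ∫ s in (0 : ℝ)..1, DeSitter.weighted H a (DeSitter.kernelK1 H M) t s
          ≤ C * Real.exp (M.re * t))) ∧
    -- the derivative in the definition of `K₀` exists
    (∀ t : ℝ, 0 < t → ∀ r ∈ Set.Icc 0 (DeSitter.phi H t),
      DifferentiableAt ℝ (fun b : ℝ => DeSitter.kernelE H M r t b) 0) ∧
    -- weighted bounds for `K₀`
    (∀ a : ℝ, -1 < a →
      (M.re < H / 2 →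
        (∃ C : ℝ, 0 < C ∧ ∀ t : ℝ, 0 < t →
          IntervalIntegrable (DeSitter.weighted H a (DeSitter.kernelK0 H M) t) volume 0 1 ∧
          ∫ s in (0 : ℝ)..1, DeSitter.weighted H a (DeSitter.kernelK0 H M) t s
            ≤ C * ((Real.exp (H * t) - 1) ^ (a + 1) * Real.exp (-(a * H * t))
                * (Real.exp (H * t) + 1) ^ (-(1 / 2) : ℝ))) ∧
        (∃ C : ℝ, 0 < C ∧ ∀ᶠ t : ℝ in atTop,
          ∫ s in (0 : ℝ)..1, DeSitter.weighted H a (DeSitter.kernelK0 H M) t s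
            ≤ C * Real.exp (1 / 2 * H * t))) ∧
      (H / 2 < M.re →
        (∃ C : ℝ, 0 < C ∧ ∀ t : ℝ, 0 < t →
          IntervalIntegrable (DeSitter.weighted H a (DeSitter.kernelK0 H M) t) volume 0 1 ∧
          ∫ s in (0 : ℝ)..1, DeSitter.weighted H a (DeSitter.kernelK0 H M) t s
            ≤ C * ((Real.exp (H * t) - 1) ^ (a + 1) * Real.exp (-(a * H * t))
                * (Real.exp (M.re * t) * (Real.exp (H * t) + 1)⁻¹))) ∧
        (∃ C : ℝ, 0 < C ∧ ∀ᶠ t : ℝ in atTop,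
          ∫ s in (0 : ℝ)..1, DeSitter.weighted H a (DeSitter.kernelK0 H M) t s
            ≤ C * Real.exp (M.re * t)))) ∧
    -- the derivative `∂_t E` exists
    (∀ t b : ℝ, 0 ≤ b → b < t →
      ∀ r ∈ Set.Icc 0 ((Real.exp (-(H * b)) - Real.exp (-(H * t))) / H),
        DifferentiableAt ℝ (fun τ : ℝ => DeSitter.kernelE H M r τ b) t) ∧
    -- bounds for `∂_t E`, uniform in `t` and `b`
    (M.re < H / 2 →
      ∃ C : ℝ, 0 < C ∧ ∀ t b : ℝ, 0 ≤ b → b < t →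
        IntervalIntegrable (fun r : ℝ => ‖DeSitter.kernelEt H M r t b‖) volume
          0 ((Real.exp (-(H * b)) - Real.exp (-(H * t))) / H) ∧
        ∫ r in (0 : ℝ)..((Real.exp (-(H * b)) - Real.exp (-(H * t))) / H),
            ‖DeSitter.kernelEt H M r t b‖
          ≤ C * Real.exp (1 / 2 * H * (t - b))) ∧
    (H / 2 < M.re →
      ∃ C : ℝ, 0 < C ∧ ∀ t b : ℝ, 0 ≤ b → b < t →
        IntervalIntegrable (fun r : ℝ => ‖DeSitter.kernelEt H M r t b‖) volume
          0 ((Real.exp (-(H * b)) - Real.exp (-(H * t))) / H) ∧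
        ∫ r in (0 : ℝ)..((Real.exp (-(H * b)) - Real.exp (-(H * t))) / H),
            ‖DeSitter.kernelEt H M r t b‖
          ≤ C * Real.exp ((M.re + H) * (t - b))) := by

  refine ⟨fun a ha => ?_, fun t ht r hr => ?_, fun a ha => ⟨fun hlt => ?_, fun hlt => ?_⟩,
    fun t b hb hbt r hr => ?_, fun hlt => ?_, fun hlt => ?_⟩
  · refine DeSitter.weighted_bounds_of_le hH ha (DeSitter.weighted_kernelK1_le hH hM ha)
      fun t ht => DeSitter.one_sub_exp_neg_rpow_mul_le hH ht ?_ ?_ a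
    · have := div_pos hM hH
      linarith
    · field_simp
      ring
  · rw [DeSitter.phi_eq] at hr
    exact (DeSitter.inCone_of_mem_Icc hH hr).differentiableAt_kernelE hH hM
  · have hK := DeSitter.weighted_kernelK0_le hH hM hlt.ne ha
    rw [max_eq_right hlt.le, show H / 2 = 1 / 2 * H by ring] at hK
    refine DeSitter.weighted_bounds_of_le hH ha hK fun t ht => ?_
    refine (DeSitter.one_sub_exp_neg_rpow_mul_le hH ht (σ := -(1 / 2)) (by norm_num)
      (by ring) a).trans_eq ?_
    ring
  · have hK := DeSitter.weighted_kernelK0_le hH hM hlt.ne' ha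
    rw [max_eq_left hlt.le] at hK
    refine DeSitter.weighted_bounds_of_le hH ha hK fun t ht => ?_
    -- Only the factor `e^{Ht}` of the weight is compared with `e^{Ht} + 1`; `e^{Re M t}` is kept.
    have h := DeSitter.one_sub_exp_neg_rpow_mul_le hH ht (σ := -1) (κ := 0) le_rfl
      (by ring) a
    rw [zero_mul, Real.exp_zero, mul_one, Real.rpow_neg_one] at h
    calc _ ≤ _ := mul_le_mul_of_nonneg_right h (Real.exp_pos (M.re * t)).le
      _ = _ := by ring
  · exact ((DeSitter.inCone_of_mem_Icc hH hr).hasDerivAt_kernelE_time hH hM).differentiableAt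
  · obtain ⟨C, hC, h⟩ := DeSitter.integral_kernelEt_le hH hM hlt.ne
    refine ⟨C, hC, fun t b _ hbt => ?_⟩
    rw [max_eq_right hlt.le, show H / 2 = 1 / 2 * H by ring] at h
    exact h t b hbt
  · obtain ⟨C, hC, h⟩ := DeSitter.integral_kernelEt_le hH hM hlt.ne'
    refine ⟨C, hC, fun t b _ hbt => ⟨(h t b hbt).1, (h t b hbt).2.trans ?_⟩⟩
    rw [max_eq_left hlt.le]
    have : 0 < t - b := sub_pos.2 hbt
    gcongr
    linarith
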